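/- **Setting.** For each $d\in\mathbb N$ let $\Omega_d$ be a separable metric space with metric $\rho$ and a Borel probability measure $\mu_d$. The concentration function of $\Omega_d$ is $\alpha_{\Omega_d}(0)=\frac12$ and $$\alpha_{\Omega_d}(\varepsilon)=1-\inf\{\mu_d(A_\varepsilon): A\subseteq\Omega_d \text{ measurable},\ \mu_d(A)\ge \tfrac12\}\quad(\varepsilon>0),\qquad A_\varepsilon=\{x:\rho(x,A)<\varepsilon\}.$$ For a class $\mathscr F$ of real functions, $\mathscr F_{\ge}$ is the family of all sets $\{\omega: f(\omega)\ge a\}$, $f\in\mathscr F$, $a\in\mathbb R$, and $\mathrm{VC\text{-}dim}$ is the supremum of the cardinalities of shattered sets. A *metric tree* on $\Omega$ with decision functions in a class $\mathscr F$ of 1-Lipschitz functions $\Omega\to\mathbb R$ is a finite rooted binary tree with a set $B_t\subseteq\Omega$ for every node $t$ (for a leaf, its bin) and a function $f_t\in\mathscr F$ for every inner node $t$, such that $B_{\mathrm{root}}=\Omega$ and, for every inner node $t$ with children $t_-,t_+$, one has $B_t\subseteq B_{t_-}\cup B_{t_+}$, $f_t\le 0$ on $B_{t_-}$ and $f_t\ge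 0$ on $B_{t_+}$. A range query with centre $\omega$ and radius $\varepsilon$ accesses the root and, from every accessed inner node $t$, the child $t_-$ iff $f_t(\omega)<\varepsilon$ and the child $t_+$ iff $f_t(\omega)>-\varepsilon$. Its cost for a finite dataset $X\subseteq\Omega$ is the number of accessed nodes plus the sum of $|X\cap B_t|$ over the accessed leaves $t$. The cost of the exact nearest neighbour search at $\omega$ is the cost of the range query of radius $\varepsilon_{NN}(\omega)=\min_{x\in X}\rho(\omega,x)$ (any larger radius costs at least as much). The expected average cost of the tree is the expectation of this cost over $\omega\sim\mu_d$. **Theorem.** Assume: 1. there are constants $C$ and $c>0$ such that, for all sufficiently large $d$, $\alpha_{\Omega_d}(\varepsilon)\le C\exp(-c\,\varepsilon^2 d)$ for all $\varepsilon\ge 0$; 2. for all sufficiently large $d$, the expected distance between two independent points is $\mathbb E_{\mu_d\otimes\mu_d}\,\rho(x,y)=1$; 3. $\mathscr F_d$ is a class of 1-Lipschitz functions $\Omega_d\to\mathbb R$ with $\mathrm{VC\text{-}dim}((\mathscr F_d)_{\ge})=d^{O(1)}$, that is, there is $k$ with $\mathrm{VC\text{-}dim}((\mathscr F_d)_{\ge})\le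 d^k$ for all sufficiently large $d$; 4. $n=n_d$ satisfies $d=n^{o(1)}$, that is, for every $k$ one has $n_d\ge d^k$ for all sufficiently large $d$, and $d=\omega(\log n)$, that is, $\log n_d=o(d)$. Let $X_d$ consist of $n_d$ i.i.d. points of $\Omega_d$ with distribution $\mu_d$, sampled independently for different $d$. Then there is a function $h:\mathbb N\to\mathbb N$ with $h(d)\to\infty$ such that, with confidence tending to $1$ as $d\to\infty$, every metric tree on $\Omega_d$ with decision functions in $\mathscr F_d$ (the tree may depend on $X_d$) has expected average exact nearest neighbour search cost at least $d^{h(d)}$ for the dataset $X_d$. Moreover, for almost every infinite sample path $(X_d)_{d\in\mathbb N}$ this holds for all sufficiently large $d$. (Here "with confidence tending to $1$" means that the outer probability of the set of samples for which the claim fails tends to $0$.) -/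

import Mathlib

open MeasureTheory Filter Topology Set
open scoped ENNReal

noncomputable section

namespace SimSearch

/-- The concentration function of a metric space with a probability measure:
`α(0) = 1/2`, and for `ε > 0` it is `1 - inf μ(A_ε)` over all measurable sets `A` of measure at
least `1/2`, where `A_ε = {x | d(x, A) < ε}` is the open `ε`-neighbourhood. -/
def concentrationFunction {Ω : Type*} [MetricSpace Ω] [MeasurableSpace Ω]
    (μ : Measure Ω) (ε : ℝ) : ℝ :=
  if ε = 0 then 1 / 2
  else 1 - sInf ((fun A : Set Ω => μ.real (Metric.thickening ε A)) ''
    {A : Set Ω | MeasurableSet A ∧ 1 / 2 ≤ μ.real A})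

/-- `B` is shattered by the family `𝒜`: every subset of `B` is a trace of a member of `𝒜`. -/
def Shatters {Ω : Type*} (𝒜 : Set (Set Ω)) (B : Set Ω) : Prop :=
  ∀ C ⊆ B, ∃ A ∈ 𝒜, A ∩ B = C

/-- The Vapnik-Chervonenkis dimension: the supremum of the cardinalities of shattered sets
(`⊤` if it is infinite). -/
def vcDim {Ω : Type*} (𝒜 : Set (Set Ω)) : ℕ∞ :=
  ⨆ (B : Set Ω) (_ : Shatters 𝒜 B), B.encard

/-- The family of all superlevel sets `{ω | a ≤ f ω}`, `f ∈ F`, `a ∈ ℝ`. -/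
def superlevelSets {Ω : Type*} (F : Set (Ω → ℝ)) : Set (Set Ω) :=
  {S | ∃ f ∈ F, ∃ a : ℝ, S = {ω | a ≤ f ω}}

/-- A finite rooted binary tree in which every node `t` carries a block `B_t ⊆ Ω` (for a leaf,
its bin), and every inner node carries also a decision function and its two children
`t₋` (first) and `t₊` (second). -/
inductive IndexTree (Ω : Type*) where
  | leaf (B : Set Ω) : IndexTree Ω
  | node (B : Set Ω) (f : Ω → ℝ) (tneg tpos : IndexTree Ω) : IndexTree Ω

namespace IndexTree

variable {Ω : Type*}

/-- The block `B_t` at the root of a tree. -/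
def block : IndexTree Ω → Set Ω
  | leaf B => B
  | node B _ _ _ => B

/-- The conditions at the inner nodes of a metric tree with decision functions in `F`:
`f_t ∈ F` is 1-Lipschitz, `B_t ⊆ B_{t₋} ∪ B_{t₊}`, `f_t ≤ 0` on `B_{t₋}`, and `f_t ≥ 0` on
`B_{t₊}`. -/
def Admissible [MetricSpace Ω] (F : Set (Ω → ℝ)) : IndexTree Ω → Prop
  | leaf _ => True
  | node B f tneg tpos =>
      f ∈ F ∧ LipschitzWith 1 f ∧ B ⊆ tneg.block ∪ tpos.block ∧
      (∀ ω ∈ tneg.block, f ω ≤ 0) ∧ (∀ ω ∈ tpos.block, 0 ≤ f ω) ∧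
      tneg.Admissible F ∧ tpos.Admissible F

/-- A metric tree on `Ω` with decision functions in `F`; the block of its root is all of `Ω`. -/
def IsMetricTree [MetricSpace Ω] (F : Set (Ω → ℝ)) (T : IndexTree Ω) : Prop :=
  T.block = Set.univ ∧ T.Admissible F

open Classical in
/-- The number of operations for the range query with centre `ω` and radius `ε` in the dataset
`X`: one for every accessed node, and one for every datapoint in the bin of an accessed leaf.
The root is accessed; from an accessed inner node `t`, the child `t₋` is accessed iff
`f_t ω < ε`, and the child `t₊` iff `-ε < f_t ω`. -/
def rangeCost (X : Set Ω) (ω : Ω) (ε : ℝ) : IndexTree Ω → ℕ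
  | leaf B => 1 + (X ∩ B).ncard
  | node _ f tneg tpos =>
      1 + (if f ω < ε then tneg.rangeCost X ω ε else 0)
        + (if -ε < f ω then tpos.rangeCost X ω ε else 0)

/-- The cost of the exact nearest neighbour search at `ω`: the range query whose radius is the
distance from `ω` to the nearest datapoint. The cost of a range query is nondecreasing in the
radius, so every range query with a larger radius costs at least as much. -/
def nnCost [MetricSpace Ω] (X : Set Ω) (T : IndexTree Ω) (ω : Ω) : ℕ :=
  T.rangeCost X ω (Metric.infDist ω X)

/-- The expected cost of the exact nearest neighbour search for a query point `ω ∼ μ`. -/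
def avgNNCost [MetricSpace Ω] [MeasurableSpace Ω] (μ : Measure Ω) (X : Set Ω)
    (T : IndexTree Ω) : ℝ≥0∞ :=
  ∫⁻ ω, (T.nnCost X ω : ℝ≥0∞) ∂μ

end IndexTree

end SimSearch

end

/-! The curse of dimensionality comes from two effects of concentration. Put `b = C exp(-c d /
256)`. Any set of measure above `b` has a 1/8-neighbourhood of measure at least `1 - b`. Since the
mean distance is 1, every ball of radius 1/8 has measure at most `b` (`measureReal_ball_le`). As `n
* b` is tiny, a typical query is at distance at least 1/8 from all datapoints, so its search costs
at least as much as the range query of radius 1/8.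

Attach to each node its cell, the intersection of the halfspaces `±f ≥ 0` met on the path from the
root. Unlike the blocks, cells are measurable and have controlled combinatorial complexity. A node
whose cell is fat (measure above `b`) is accessed by at least half of the queries, because decision
functions are 1-Lipschitz. Cut the tree at the first thin cells. With `v` fat nodes and `w`
datapoints in the bins of fat leaves, the average cost is at least `(v + w) / 2`, and at most `v +
1` thin subtrees are cut off (`IndexTree.exists_le_lintegral_rangeCost`). A cost below `Q` forces `v
+ w < 2 * Q`, so all remaining datapoints lie in at most `2 * Q` thin cells, each cut out by at most
`2 * Q` halfspaces.

This is impossible if no such thin cell holds more than about `n / (8 * Q)` datapoints. That is a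
Vapnik-Chervonenkis estimate, uniform over all trees (`measure_exists_cell_mul_le`): a ghost sample
probably misses a thin cell, random swaps make a large discrepancy exponentially unlikely, and the
Sauer-Shelah bound limits the number of traces of cells. With `Q = d ^ k` the failure probability is
at most `1 / d ^ 2`. A diagonal choice of `k` and the Borel-Cantelli lemma finish the proof. -/

namespace SimSearch

/-! ### Consequences of concentration for neighbourhoods. -/

section Concentration

variable {Ω : Type*} [MetricSpace Ω] [MeasurableSpace Ω] {μ : Measure Ω}

/-- Sets of measure at least one half have neighbourhoods of almost full measure. -/
theorem one_sub_le_measureReal_thickening {δ b : ℝ} (hδ : 0 < δ)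
    (hb : concentrationFunction μ δ ≤ b) {A : Set Ω} (hA : MeasurableSet A)
    (hA2 : 1 / 2 ≤ μ.real A) : 1 - b ≤ μ.real (Metric.thickening δ A) := by
  have hle : sInf ((fun A : Set Ω => μ.real (Metric.thickening δ A)) ''
      {A : Set Ω | MeasurableSet A ∧ 1 / 2 ≤ μ.real A}) ≤ μ.real (Metric.thickening δ A) :=
    csInf_le ⟨0, by rintro _ ⟨B, -, rfl⟩; exact measureReal_nonneg⟩ ⟨A, ⟨hA, hA2⟩, rfl⟩
  rw [concentrationFunction, if_neg hδ.ne'] at hb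
  linarith

variable [BorelSpace Ω] [IsProbabilityMeasure μ]

/-- Sets of measure exceeding the concentration function have neighbourhoods of measure at
least one half. -/
theorem half_le_measureReal_thickening {δ b : ℝ} (hδ : 0 < δ)
    (hb : concentrationFunction μ δ ≤ b) {A : Set Ω} (hA : MeasurableSet A)
    (hA2 : b < μ.real A) : 1 / 2 ≤ μ.real (Metric.thickening δ A) := by
  by_contra! hlt
  have hm : MeasurableSet (Metric.thickening δ A) := Metric.isOpen_thickening.measurableSet
  have h1 : 1 / 2 ≤ μ.real (Metric.thickening δ A)ᶜ := by
    rw [probReal_compl_eq_one_sub hm]; linarith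
  have h2 := one_sub_le_measureReal_thickening hδ hb hm.compl h1
  -- The complement of the neighbourhood would have measure at least 1/2, yet its own neighbourhood
  -- misses `A`.
  have hdisj : Metric.thickening δ (Metric.thickening δ A)ᶜ ⊆ Aᶜ := by
    intro x hx hxA
    obtain ⟨y, hy, hxy⟩ := Metric.mem_thickening_iff.1 hx
    exact hy (Metric.mem_thickening_iff.2 ⟨x, hxA, by rwa [dist_comm]⟩)
  have h3 := measureReal_mono (μ := μ) hdisj
  rw [probReal_compl_eq_one_sub hA] at h3
  linarith

/-- Two steps of length `δ`: the first grows the set to measure one half, the second to almost full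
measure. -/
theorem one_sub_le_measureReal_thickening_of_lt {δ b : ℝ} (hδ : 0 < δ)
    (hb : concentrationFunction μ δ ≤ b) {A : Set Ω} (hA : MeasurableSet A)
    (hA2 : b < μ.real A) : 1 - b ≤ μ.real (Metric.thickening (δ + δ) A) :=
  (one_sub_le_measureReal_thickening hδ hb Metric.isOpen_thickening.measurableSet
    (half_le_measureReal_thickening hδ hb hA hA2)).trans
    (measureReal_mono (Metric.thickening_thickening_subset _ _ _))

end Concentration

/-! ### Search cost and cells of a metric tree. -/

section Tree

variable {Ω : Type*}

/-- The cell cut out by finitely many conditions `0 ≤ g`. -/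
def cell (l : List (Ω → ℝ)) : Set Ω := {ω | ∀ g ∈ l, 0 ≤ g ω}

theorem cell_cons (g : Ω → ℝ) (l : List (Ω → ℝ)) : cell (g :: l) = {ω | 0 ≤ g ω} ∩ cell l := by
  ext ω; simp [cell]

theorem measurableSet_cell [MeasurableSpace Ω] {l : List (Ω → ℝ)} (hl : ∀ g ∈ l, Measurable g) :
    MeasurableSet (cell l) := by
  induction l with
  | nil => simp [cell]
  | cons g l ih =>
    rw [cell_cons]
    exact (measurableSet_le measurable_const (hl g (by simp))).inter
      (ih fun g hg => hl g (List.mem_cons_of_mem _ hg))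

/-- `g` or `-g` is a decision function. -/
def IsSigned (F : Set (Ω → ℝ)) (g : Ω → ℝ) : Prop := g ∈ F ∨ -g ∈ F

theorem IsSigned.lipschitzWith [MetricSpace Ω] {F : Set (Ω → ℝ)}
    (hF : ∀ f ∈ F, LipschitzWith 1 f) {g : Ω → ℝ} (hg : IsSigned F g) : LipschitzWith 1 g := by
  rcases hg with h | h
  · exact hF g h
  · simpa using (hF _ h).neg

namespace IndexTree

theorem rangeCost_mono (X : Set Ω) (ω : Ω) {ε ε' : ℝ} (h : ε ≤ ε') (T : IndexTree Ω) :
    T.rangeCost X ω ε ≤ T.rangeCost X ω ε' := by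
  induction T with
  | leaf B => simp [rangeCost]
  | node B f tneg tpos ih1 ih2 =>
    simp only [rangeCost]
    gcongr <;> split_ifs <;> first | assumption | positivity | linarith

end IndexTree

/-- The bound `-ε < g ω` is the access condition: a query within `ε` of a child's cell passes from
the parent to that child. -/
theorem thickening_cell_cons_subset [MetricSpace Ω] {g : Ω → ℝ} (hg : LipschitzWith 1 g) (ε : ℝ)
    (l : List (Ω → ℝ)) :
    Metric.thickening ε (cell (g :: l)) ⊆ Metric.thickening ε (cell l) ∩ {ω | -ε < g ω} := by
  intro ω hω
  obtain ⟨y, hy, hd⟩ := Metric.mem_thickening_iff.1 hω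
  have h0 : 0 ≤ g y := hy g List.mem_cons_self
  have h1 : |g ω - g y| ≤ dist ω y := by simpa [Real.dist_eq] using hg.dist_le_mul ω y
  have h2 := neg_abs_le (g ω - g y)
  refine mem_inter (Metric.mem_thickening_iff.2
    ⟨y, fun g' hg' => hy g' (List.mem_cons_of_mem _ hg'), hd⟩) (mem_ofPred.2 ?_)
  linarith

/-- A lower bound for the cost of the range query of radius `ε` in a subtree in terms of the
number `v` of its nodes with large cell and the number `w` of datapoints in its leaves with large
cell. -/
theorem IndexTree.exists_le_lintegral_rangeCost [MetricSpace Ω] [MeasurableSpace Ω] [BorelSpace Ω]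
    {μ : Measure Ω} {F : Set (Ω → ℝ)} (hF : ∀ f ∈ F, LipschitzWith 1 f) {X G : Set Ω}
    (hX : X.Finite) (hG : MeasurableSet G) {ε : ℝ} {β : ℝ≥0∞} {p M : ℕ}
    (hfat : ∀ S, MeasurableSet S → β < μ S → 2⁻¹ ≤ μ (Metric.thickening ε S ∩ G))
    (hthin : ∀ l : List (Ω → ℝ), (∀ g ∈ l, IsSigned F g) → l.length ≤ M → μ (cell l) ≤ β →
      (X ∩ cell l).ncard ≤ p)
    (T : IndexTree Ω) (hT : T.Admissible F) (l : List (Ω → ℝ)) (hl : ∀ g ∈ l, IsSigned F g) :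
    ∃ v w : ℕ, ((v + w : ℕ) : ℝ≥0∞) * 2⁻¹ ≤
        ∫⁻ ω in Metric.thickening ε (cell l) ∩ G, (T.rangeCost X ω ε : ℝ≥0∞) ∂μ ∧
      (l.length + v ≤ M → (X ∩ cell l ∩ T.block).ncard ≤ w + p * (v + 1)) := by
  induction T generalizing l with
  | leaf B =>
    rcases le_or_gt (μ (cell l)) β with hβ | hβ
    · refine ⟨0, 0, by simp, fun h => ?_⟩
      have h1 := hthin l hl (by omega) hβ
      have h2 : (X ∩ cell l ∩ B).ncard ≤ (X ∩ cell l).ncard :=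
        ncard_le_ncard inter_subset_left (hX.inter_of_left _)
      simp only [IndexTree.block]
      omega
    · refine ⟨1, (X ∩ B).ncard, ?_, fun h => ?_⟩
      · have hm := hfat _ (measurableSet_cell fun g hg =>
          ((hl g hg).lipschitzWith hF).continuous.measurable) hβ
        simp only [IndexTree.rangeCost, lintegral_const, Measure.restrict_apply_univ]
        gcongr
      · have h2 : (X ∩ cell l ∩ B).ncard ≤ (X ∩ B).ncard :=
          ncard_le_ncard (by intro x hx; exact ⟨hx.1.1, hx.2⟩) (hX.inter_of_left _)
        simp only [IndexTree.block]
        omega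
  | node B f tneg tpos ih1 ih2 =>
    obtain ⟨hfF, hfL, hcov, hneg, hpos, hTn, hTp⟩ := hT
    rcases le_or_gt (μ (cell l)) β with hβ | hβ
    · refine ⟨0, 0, by simp, fun h => ?_⟩
      have h1 := hthin l hl (by omega) hβ
      have h2 : (X ∩ cell l ∩ B).ncard ≤ (X ∩ cell l).ncard :=
        ncard_le_ncard inter_subset_left (hX.inter_of_left _)
      simp only [IndexTree.block]
      omega
    · obtain ⟨v1, w1, hJ1, hc1⟩ := ih1 hTn (-f :: l) (by
        intro g hg
        rcases List.mem_cons.1 hg with rfl | hg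
        · exact Or.inr (by simpa using hfF)
        · exact hl g hg)
      obtain ⟨v2, w2, hJ2, hc2⟩ := ih2 hTp (f :: l) (by
        intro g hg
        rcases List.mem_cons.1 hg with rfl | hg
        · exact Or.inl hfF
        · exact hl g hg)
      -- The fat node itself adds 1 to `v`. This pays for the extra condition in the children's
      -- cells, and `(v1 + 1) + (v2 + 1) = v + 1` keeps the count of thin subtrees.
      refine ⟨1 + v1 + v2, w1 + w2, ?_, fun h => ?_⟩
      · have hm := hfat _ (measurableSet_cell fun g hg =>
          ((hl g hg).lipschitzWith hF).continuous.measurable) hβ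
        have hs1 := thickening_cell_cons_subset hfL.neg ε l
        have hs2 := thickening_cell_cons_subset hfL ε l
        set W := Metric.thickening ε (cell l) ∩ G
        set W1 := Metric.thickening ε (cell (-f :: l)) ∩ G
        set W2 := Metric.thickening ε (cell (f :: l)) ∩ G
        have mW1 : MeasurableSet W1 := Metric.isOpen_thickening.measurableSet.inter hG
        have mW2 : MeasurableSet W2 := Metric.isOpen_thickening.measurableSet.inter hG
        have i1 : W1 ⊆ W := fun x hx => ⟨(hs1 hx.1).1, hx.2⟩
        have i2 : W2 ⊆ W := fun x hx => ⟨(hs2 hx.1).1, hx.2⟩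
        calc ((1 + v1 + v2 + (w1 + w2) : ℕ) : ℝ≥0∞) * 2⁻¹
            = 2⁻¹ + ((v1 + w1 : ℕ) : ℝ≥0∞) * 2⁻¹ + ((v2 + w2 : ℕ) : ℝ≥0∞) * 2⁻¹ := by
              push_cast; ring
          _ ≤ μ W + (∫⁻ ω in W1, (tneg.rangeCost X ω ε : ℝ≥0∞) ∂μ)
              + ∫⁻ ω in W2, (tpos.rangeCost X ω ε : ℝ≥0∞) ∂μ := by gcongr
          _ = (∫⁻ ω in W, 1 ∂μ)
              + (∫⁻ ω in W, W1.indicator (fun ω => (tneg.rangeCost X ω ε : ℝ≥0∞)) ω ∂μ)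
              + ∫⁻ ω in W, W2.indicator (fun ω => (tpos.rangeCost X ω ε : ℝ≥0∞)) ω ∂μ := by
              rw [lintegral_indicator mW1, lintegral_indicator mW2,
                Measure.restrict_restrict mW1, Measure.restrict_restrict mW2,
                inter_eq_left.2 i1, inter_eq_left.2 i2, setLIntegral_one]
          _ ≤ ∫⁻ ω in W, (1 + W1.indicator (fun ω => (tneg.rangeCost X ω ε : ℝ≥0∞)) ω)
              + W2.indicator (fun ω => (tpos.rangeCost X ω ε : ℝ≥0∞)) ω ∂μ := by
              refine le_trans ?_ (le_lintegral_add _ _)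
              gcongr
              exact le_lintegral_add _ _
          _ ≤ _ := by
              refine lintegral_mono fun ω => ?_
              simp only [IndexTree.rangeCost]
              push_cast
              gcongr
              · by_cases hω : ω ∈ W1
                · have h1 : -ε < -f ω := (hs1 hω.1).2
                  rw [indicator_of_mem hω, if_pos (by linarith)]
                · rw [indicator_of_notMem hω]
                  positivity
              · by_cases hω : ω ∈ W2
                · have h1 : -ε < f ω := (hs2 hω.1).2
                  rw [indicator_of_mem hω, if_pos h1]
                · rw [indicator_of_notMem hω]
                  positivity
      · have h1 := hc1 (by simp only [List.length_cons]; omega)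
        have h2 := hc2 (by simp only [List.length_cons]; omega)
        have h3 : X ∩ cell l ∩ B ⊆
            (X ∩ cell (-f :: l) ∩ tneg.block) ∪ (X ∩ cell (f :: l) ∩ tpos.block) := by
          rintro x ⟨⟨hxX, hxl⟩, hxB⟩
          rcases hcov hxB with hx | hx
          · left
            refine ⟨⟨hxX, ?_⟩, hx⟩
            rw [cell_cons]
            exact ⟨by simpa using hneg x hx, hxl⟩
          · right
            refine ⟨⟨hxX, ?_⟩, hx⟩
            rw [cell_cons]
            exact ⟨hpos x hx, hxl⟩
        have h4 := (ncard_le_ncard h3 (((hX.inter_of_left _).inter_of_left _).union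
          ((hX.inter_of_left _).inter_of_left _))).trans (ncard_union_le _ _)
        simp only [IndexTree.block]
        calc _ ≤ _ := h4
          _ ≤ (w1 + p * (v1 + 1)) + (w2 + p * (v2 + 1)) := add_le_add h1 h2
          _ = _ := by ring

/-- If cells of small measure contain few datapoints, the exact nearest neighbour search in a
metric tree is expensive. -/
theorem IndexTree.le_avgNNCost [MetricSpace Ω] [MeasurableSpace Ω] [BorelSpace Ω]
    {μ : Measure Ω} {F : Set (Ω → ℝ)} (hF : ∀ f ∈ F, LipschitzWith 1 f) {X : Set Ω}
    (hX : X.Finite) {ε : ℝ} {β : ℝ≥0∞} {p Q : ℕ}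
    (hfat : ∀ S, MeasurableSet S → β < μ S →
      2⁻¹ ≤ μ (Metric.thickening ε S ∩ {ω | ε ≤ Metric.infDist ω X}))
    (hthin : ∀ l : List (Ω → ℝ), (∀ g ∈ l, IsSigned F g) → l.length ≤ 2 * Q → μ (cell l) ≤ β →
      (X ∩ cell l).ncard ≤ p) (hcard : 2 * Q + p * (2 * Q + 1) < X.ncard)
    {T : IndexTree Ω} (hT : T.IsMetricTree F) : (Q : ℝ≥0∞) ≤ T.avgNNCost μ X := by
  by_contra! hlt
  set G : Set Ω := {ω | ε ≤ Metric.infDist ω X}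
  have hG : MeasurableSet G :=
    measurableSet_le measurable_const (Metric.continuous_infDist_pt X).measurable
  obtain ⟨v, w, hJ, hc⟩ :=
    IndexTree.exists_le_lintegral_rangeCost hF hX hG hfat hthin T hT.2 [] (by simp)
  -- On `G` the nearest neighbour radius is at least `ε`, so monotonicity in the radius applies.
  have h1 : ∫⁻ ω in Metric.thickening ε (cell []) ∩ G, (T.rangeCost X ω ε : ℝ≥0∞) ∂μ
      ≤ T.avgNNCost μ X := by
    refine (setLIntegral_mono_ae' (g := fun ω => (T.nnCost X ω : ℝ≥0∞))
      (Metric.isOpen_thickening.measurableSet.inter hG) (Eventually.of_forall fun ω hω => ?_)).trans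
      (setLIntegral_le_lintegral _ _)
    exact_mod_cast IndexTree.rangeCost_mono X ω hω.2 T
  have h2 : ((v + w : ℕ) : ℝ≥0∞) < 2 * Q := by
    rw [mul_comm]
    exact (ENNReal.div_lt_iff (by simp) (by simp)).1 ((hJ.trans h1).trans_lt hlt)
  -- Few fat nodes also means short paths, so no separate bound on the depth of the tree is needed.
  have h3 : v + w < 2 * Q := by exact_mod_cast h2
  have h4 := hc (by simp only [List.length_nil]; omega)
  rw [hT.1, inter_univ, show cell ([] : List (Ω → ℝ)) = univ by simp [cell], inter_univ] at h4
  have h5 : p * (v + 1) ≤ p * (2 * Q + 1) := by gcongr; omega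
  omega

end Tree

/-! ### Counting the traces of cells on a finite sequence of points. -/

section Growth

theorem sum_choose_le_pow (N D : ℕ) : ∑ i ∈ Finset.Iic D, N.choose i ≤ (N + 1) ^ D := by
  induction D with
  | zero => simp [show Finset.Iic 0 = {0} from rfl]
  | succ D ih =>
    have h : Finset.Iic (D + 1) = insert (D + 1) (Finset.Iic D) := by
      ext i; simp only [Finset.mem_Iic, Finset.mem_insert]; omega
    rw [h, Finset.sum_insert (by simp)]
    have h1 : N.choose (D + 1) ≤ N * (N + 1) ^ D := by
      calc N.choose (D + 1) ≤ N ^ (D + 1) := Nat.choose_le_pow _ _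
        _ = N * N ^ D := by ring
        _ ≤ N * (N + 1) ^ D := by gcongr; omega
    calc _ ≤ N * (N + 1) ^ D + (N + 1) ^ D := add_le_add h1 ih
      _ = _ := by ring

variable {Ω I : Type*} [Fintype I]

open Classical in
/-- The family of traces of a family of sets on a finite sequence of points. -/
noncomputable def traces (𝒜 : Set (Set Ω)) (z : I → Ω) : Finset (Finset I) :=
  Finset.univ.filter fun t => ∃ A ∈ 𝒜, ∀ i, i ∈ t ↔ z i ∈ A

theorem mem_traces {𝒜 : Set (Set Ω)} {z : I → Ω} {t : Finset I} :
    t ∈ traces 𝒜 z ↔ ∃ A ∈ 𝒜, ∀ i, i ∈ t ↔ z i ∈ A := by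
  simp [traces]

/-- The Sauer-Shelah bound. -/
theorem card_traces_le {𝒜 : Set (Set Ω)} {D : ℕ} (hD : vcDim 𝒜 ≤ D) (z : I → Ω) :
    (traces 𝒜 z).card ≤ (Fintype.card I + 1) ^ D := by
  classical
  have hsh : ∀ s : Finset I, (traces 𝒜 z).Shatters s → s.card ≤ D := by
    intro s hs
    have hinj : InjOn z s := by
      intro i hi j hj hij
      obtain ⟨u, hu, hsu⟩ := hs (Finset.singleton_subset_iff.2 hi)
      obtain ⟨A, -, hA⟩ := mem_traces.1 hu
      have h1 : i ∈ s ∩ u := hsu ▸ Finset.mem_singleton_self i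
      have h2 : j ∈ u := (hA j).2 (hij ▸ (hA i).1 (Finset.mem_inter.1 h1).2)
      have h3 : j ∈ s ∩ u := Finset.mem_inter.2 ⟨hj, h2⟩
      rw [hsu, Finset.mem_singleton] at h3
      exact h3.symm
    have hz : Shatters 𝒜 (z '' s) := by
      intro C hC
      obtain ⟨u, hu, hsu⟩ := hs (Finset.filter_subset (fun i => z i ∈ C) s)
      obtain ⟨A, hA𝒜, hA⟩ := mem_traces.1 hu
      refine ⟨A, hA𝒜, Subset.antisymm ?_ fun ω hω => ?_⟩
      · rintro _ ⟨hωA, i, hi, rfl⟩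
        have h1 : i ∈ s ∩ u := Finset.mem_inter.2 ⟨hi, (hA i).2 hωA⟩
        rw [hsu, Finset.mem_filter] at h1
        exact h1.2
      · obtain ⟨i, hi, rfl⟩ := hC hω
        have h1 : i ∈ s ∩ u := by
          rw [hsu, Finset.mem_filter]; exact ⟨hi, hω⟩
        exact ⟨(hA i).1 (Finset.mem_inter.1 h1).2, i, hi, rfl⟩
    have h1 : (z '' s).encard ≤ D :=
      (le_iSup₂ (f := fun (B : Set Ω) (_ : Shatters 𝒜 B) => B.encard) _ hz).trans hD
    rw [hinj.encard_image, encard_coe_eq_coe_finsetCard] at h1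
    exact_mod_cast h1
  have hvc : (traces 𝒜 z).vcDim ≤ D :=
    Finset.sup_le fun s hs => hsh s (Finset.mem_shatterer.1 hs)
  calc (traces 𝒜 z).card ≤ (traces 𝒜 z).shatterer.card := Finset.card_le_card_shatterer _
    _ ≤ ∑ k ∈ Finset.Iic (traces 𝒜 z).vcDim, (Fintype.card I).choose k :=
      Finset.card_shatterer_le_sum_vcDim
    _ ≤ ∑ k ∈ Finset.Iic D, (Fintype.card I).choose k :=
      Finset.sum_le_sum_of_subset (Finset.Iic_subset_Iic.2 hvc)
    _ ≤ _ := sum_choose_le_pow _ _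

/-- On finitely many points an open halfspace has the trace of a closed one with a slightly larger
threshold; this brings strict inequalities under `superlevelSets`. -/
theorem exists_forall_le_iff_lt (v : I → ℝ) (c : ℝ) : ∃ a, ∀ i, a ≤ v i ↔ c < v i := by
  have h : ∀ᶠ a in 𝓝[>] c, ∀ i, a ≤ v i ↔ c < v i := by
    refine Filter.eventually_all.2 fun i => ?_
    rcases lt_or_ge c (v i) with hi | hi
    · filter_upwards [Ioo_mem_nhdsGT hi] with a ha
      exact ⟨fun _ => hi, fun _ => ha.2.le⟩
    · filter_upwards [self_mem_nhdsWithin] with a ha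
      exact ⟨fun h => ha.trans_le h, fun h => absurd hi h.not_ge⟩
  exact h.exists

/-- A bound for the number of traces of intersections of at most `M` halfspaces. -/
theorem exists_traces_cell (F : Set (Ω → ℝ)) {D : ℕ} (hD : vcDim (superlevelSets F) ≤ D)
    (z : I → Ω) (M : ℕ) :
    ∃ 𝒯 : Finset (Finset I), 𝒯.card ≤ (2 * (Fintype.card I + 1) ^ D + 1) ^ M ∧
      ∀ l : List (Ω → ℝ), (∀ g ∈ l, IsSigned F g) → l.length ≤ M → ∀ c : ℝ,
        ∃ t ∈ 𝒯, ∀ i, i ∈ t ↔ ∀ g ∈ l, c < g (z i) := by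
  classical
  set 𝒮 := traces (superlevelSets F) z
  -- Complements account for functions with `-g ∈ F`; the full set pads lists with fewer than `M`
  -- conditions.
  set 𝒜 : Finset (Finset I) := insert Finset.univ (𝒮 ∪ 𝒮.image compl)
  have hcard : 𝒜.card ≤ 2 * (Fintype.card I + 1) ^ D + 1 := by
    have h1 : 𝒜.card ≤ _ := Finset.card_insert_le (Finset.univ : Finset I) (𝒮 ∪ 𝒮.image compl)
    have h2 := Finset.card_union_le 𝒮 (𝒮.image compl)
    have h3 : (𝒮.image compl).card ≤ 𝒮.card := Finset.card_image_le
    have h4 : 𝒮.card ≤ _ := card_traces_le hD z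
    omega
  have hmem : ∀ g, IsSigned F g → ∀ c : ℝ, ∃ t ∈ 𝒜, ∀ i, i ∈ t ↔ c < g (z i) := by
    rintro g (hg | hg) c
    · obtain ⟨a, ha⟩ := exists_forall_le_iff_lt (fun i => g (z i)) c
      refine ⟨Finset.univ.filter fun i => a ≤ g (z i), ?_, fun i => by simpa using ha i⟩
      refine Finset.mem_insert_of_mem (Finset.mem_union_left _ (mem_traces.2 ?_))
      exact ⟨_, ⟨g, hg, a, rfl⟩, fun i => by simp⟩
    · refine ⟨(Finset.univ.filter fun i => -c ≤ (-g) (z i))ᶜ, ?_, fun i => by simp⟩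
      refine Finset.mem_insert_of_mem (Finset.mem_union_right _ (Finset.mem_image_of_mem _
        (mem_traces.2 ?_)))
      exact ⟨_, ⟨-g, hg, -c, rfl⟩, fun i => by simp⟩
  induction M with
  | zero =>
    refine ⟨{Finset.univ}, by simp, fun l _ hl c => ⟨Finset.univ, by simp, ?_⟩⟩
    obtain rfl : l = [] := List.length_eq_zero_iff.1 (by omega)
    simp
  | succ M ih =>
    obtain ⟨𝒯, h𝒯, hl𝒯⟩ := ih
    refine ⟨Finset.image₂ (· ∩ ·) 𝒜 𝒯, ?_, fun l hl hM c => ?_⟩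
    · calc _ ≤ 𝒜.card * 𝒯.card := Finset.card_image₂_le _ _ _
        _ ≤ _ := Nat.mul_le_mul hcard h𝒯
        _ = _ := by ring
    · cases l with
      | nil =>
        obtain ⟨t, ht, hti⟩ := hl𝒯 [] (by simp) (by simp) c
        exact ⟨Finset.univ ∩ t, Finset.mem_image₂_of_mem (Finset.mem_insert_self _ _) ht,
          fun i => by simpa using hti i⟩
      | cons g l =>
        obtain ⟨t, ht, hti⟩ := hl𝒯 l (fun g hg => hl g (List.mem_cons_of_mem _ hg))
          (by simpa using hM) c
        obtain ⟨s, hs, hsi⟩ := hmem g (hl g List.mem_cons_self) c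
        exact ⟨s ∩ t, Finset.mem_image₂_of_mem hs ht, fun i => by simp [hti, hsi]⟩

end Growth

/-! ### Random choices from pairs. -/

section Swap

variable {ι : Type*} [Fintype ι]

open Classical in
/-- The number of choices of one point from each of several pairs such that at least `p` of the
chosen points and none of the others belong to a given set. -/
theorem card_choices_mul_le (T : Finset (ι × Bool)) (p : ℕ) :
    (Finset.univ.filter fun σ : ι → Bool =>
      (∃ s : Finset ι, p ≤ s.card ∧ ∀ i ∈ s, (i, σ i) ∈ T) ∧ ∀ i, (i, !σ i) ∉ T).card * 2 ^ p
      ≤ 2 ^ Fintype.card ι := by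
  set S := Finset.univ.filter fun σ : ι → Bool =>
    (∃ s : Finset ι, p ≤ s.card ∧ ∀ i ∈ s, (i, σ i) ∈ T) ∧ ∀ i, (i, !σ i) ∉ T with hS
  rcases S.eq_empty_or_nonempty with h0 | ⟨σ₀, hσ₀⟩
  · simp [h0]
  obtain ⟨⟨s, hsp, hs⟩, -⟩ := (Finset.mem_filter.1 hσ₀).2
  -- One admissible choice `σ₀` puts `(i, σ₀ i)` in `T` for all `i ∈ s`. Another admissible choice
  -- may not leave these points unselected, so it agrees with `σ₀` on `s`.
  have hsub : S ⊆ Fintype.piFinset fun i => if i ∈ s then {σ₀ i} else Finset.univ := by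
    intro σ hσ
    obtain ⟨-, hσ2⟩ := (Finset.mem_filter.1 hσ).2
    refine Fintype.mem_piFinset.2 fun i => ?_
    split_ifs with hi
    · rw [Finset.mem_singleton]
      by_contra hne
      have h1 : (!σ i) = σ₀ i := by
        cases h : σ i <;> cases h' : σ₀ i <;> simp_all
      exact hσ2 i (h1 ▸ hs i hi)
    · simp
  have hcard := Finset.card_le_card hsub
  rw [Fintype.card_piFinset] at hcard
  have hprod : ∏ i, (if i ∈ s then ({σ₀ i} : Finset Bool) else Finset.univ).card
      = 2 ^ sᶜ.card := by
    rw [← Finset.prod_mul_prod_compl s, Finset.prod_congr rfl (g := fun _ => 1) (by simp +contextual),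
      Finset.prod_congr (s₁ := sᶜ) rfl (g := fun _ => 2) (by simp +contextual)]
    simp
  rw [hprod] at hcard
  calc S.card * 2 ^ p ≤ 2 ^ sᶜ.card * 2 ^ s.card :=
      Nat.mul_le_mul hcard (Nat.pow_le_pow_right (by norm_num) hsp)
    _ = 2 ^ Fintype.card ι := by rw [← pow_add, add_comm, Finset.card_add_card_compl]

end Swap

/-! ### Symmetrization with a ghost sample. -/

section GhostSample

variable {Ω ι : Type*} [Fintype ι]

/-- The pairs of samples such that some intersection of at most `M` open halfspaces contains at
least `p` points of the first sample and is at a positive distance from the second one. -/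
def discrepantPairs (F : Set (Ω → ℝ)) (ι : Type*) (M p : ℕ) : Set (ι → Ω × Ω) :=
  {w | ∃ l : List (Ω → ℝ), (∀ g ∈ l, IsSigned F g) ∧ l.length ≤ M ∧ ∃ η : ℝ,
    (∃ s : Finset ι, p ≤ s.card ∧ ∀ i ∈ s, ∀ g ∈ l, -η < g (w i).1) ∧
    ∀ i, ∃ g ∈ l, g (w i).2 < -η}

/-- The event is a union over a possibly uncountable class; the strict inequalities with slack `η`
make it open, which gives measurability. -/
theorem isOpen_discrepantPairs [MetricSpace Ω] {F : Set (Ω → ℝ)}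
    (hF : ∀ f ∈ F, LipschitzWith 1 f) (M p : ℕ) : IsOpen (discrepantPairs F ι M p) := by
  refine isOpen_iff_eventually.2 ?_
  rintro w ⟨l, hl, hM, η, ⟨s, hs, hsl⟩, hy⟩
  have hc : ∀ g ∈ l, Continuous g := fun g hg => ((hl g hg).lipschitzWith hF).continuous
  have h1 : ∀ᶠ w' in 𝓝 w, ∀ i ∈ s, ∀ g ∈ l, -η < g (w' i).1 := by
    refine (Filter.eventually_all_finset s).2 fun i hi => ?_
    refine (Filter.eventually_all_finite l.finite_toSet).2 fun g hg => ?_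
    have hc' : Continuous fun w' : ι → Ω × Ω => g (w' i).1 := (hc g hg).comp (by fun_prop)
    exact hc'.continuousAt.eventually_const_lt (hsl i hi g hg)
  have h2 : ∀ᶠ w' in 𝓝 w, ∀ i, ∃ g ∈ l, g (w' i).2 < -η := by
    refine Filter.eventually_all.2 fun i => ?_
    obtain ⟨g, hg, hlt⟩ := hy i
    have hc' : Continuous fun w' : ι → Ω × Ω => g (w' i).2 := (hc g hg).comp (by fun_prop)
    filter_upwards [hc'.continuousAt.eventually_lt_const hlt] with w' hw'
    exact ⟨g, hg, hw'⟩
  filter_upwards [h1, h2] with w' h1 h2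
  exact ⟨l, hl, hM, η, ⟨s, hs, h1⟩, h2⟩

/-- Exchange of the two points of the pairs selected by `σ`. -/
def swapPairs (σ : ι → Bool) (w : ι → Ω × Ω) : ι → Ω × Ω :=
  fun i => (if σ i then Prod.swap else id) (w i)

theorem measurePreserving_swapPairs [MeasurableSpace Ω] (μ : Measure Ω) [IsProbabilityMeasure μ]
    (σ : ι → Bool) : MeasurePreserving (swapPairs (Ω := Ω) σ)
      (Measure.pi fun _ => μ.prod μ) (Measure.pi fun _ => μ.prod μ) := by
  refine measurePreserving_pi (fun _ => μ.prod μ) (fun _ => μ.prod μ)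
    (f := fun i => if σ i then Prod.swap else id) fun i => ?_
  split_ifs
  · exact Measure.measurePreserving_swap
  · exact MeasurePreserving.id _

-- Once the pairs are fixed, a cell matters only through its trace on the points of both samples.
-- The bound for one trace is summed over all traces.
open Classical in
theorem card_swapPairs_mem_mul_le (F : Set (Ω → ℝ)) {D : ℕ}
    (hD : vcDim (superlevelSets F) ≤ D) (M p : ℕ) (w : ι → Ω × Ω) :
    (Finset.univ.filter fun σ : ι → Bool => swapPairs σ w ∈ discrepantPairs F ι M p).card * 2 ^ p ≤
      (2 * (2 * Fintype.card ι + 1) ^ D + 1) ^ M * 2 ^ Fintype.card ι := by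
  set z : ι × Bool → Ω := fun j => if j.2 then (w j.1).2 else (w j.1).1
  have hz1 : ∀ σ i, (swapPairs σ w i).1 = z (i, σ i) := by
    intro σ i; simp only [swapPairs, z]; cases σ i <;> simp
  have hz2 : ∀ σ i, (swapPairs σ w i).2 = z (i, !σ i) := by
    intro σ i; simp only [swapPairs, z]; cases σ i <;> simp
  obtain ⟨𝒯, h𝒯, hl⟩ := exists_traces_cell F hD z M
  rw [Fintype.card_prod, Fintype.card_bool, mul_comm (Fintype.card ι)] at h𝒯
  set bad : Finset (ι × Bool) → Finset (ι → Bool) := fun T => Finset.univ.filter fun σ =>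
    (∃ s : Finset ι, p ≤ s.card ∧ ∀ i ∈ s, (i, σ i) ∈ T) ∧ ∀ i, (i, !σ i) ∉ T
  have hsub : (Finset.univ.filter fun σ : ι → Bool => swapPairs σ w ∈ discrepantPairs F ι M p) ⊆
      𝒯.biUnion bad := by
    intro σ hσ
    obtain ⟨l, hlF, hM, η, ⟨s, hs, hsl⟩, hy⟩ := (Finset.mem_filter.1 hσ).2
    obtain ⟨T, hT, hTi⟩ := hl l hlF hM (-η)
    refine Finset.mem_biUnion.2 ⟨T, hT, Finset.mem_filter.2 ⟨Finset.mem_univ _,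
      ⟨s, hs, fun i hi => (hTi _).2 fun g hg => ?_⟩, fun i hi => ?_⟩⟩
    · rw [← hz1]; exact hsl i hi g hg
    · obtain ⟨g, hg, hlt⟩ := hy i
      rw [hz2] at hlt
      exact lt_asymm hlt ((hTi _).1 hi g hg)
  calc _ ≤ (∑ T ∈ 𝒯, (bad T).card) * 2 ^ p :=
        Nat.mul_le_mul_right _ ((Finset.card_le_card hsub).trans Finset.card_biUnion_le)
    _ = ∑ T ∈ 𝒯, (bad T).card * 2 ^ p := Finset.sum_mul _ _ _
    _ ≤ ∑ T ∈ 𝒯, 2 ^ Fintype.card ι := Finset.sum_le_sum fun T _ => card_choices_mul_le T p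
    _ = 𝒯.card * 2 ^ Fintype.card ι := by rw [Finset.sum_const, smul_eq_mul]
    _ ≤ _ := Nat.mul_le_mul_right _ h𝒯

variable [MetricSpace Ω] [SecondCountableTopology Ω] [MeasurableSpace Ω] [BorelSpace Ω]
  (μ : Measure Ω) [IsProbabilityMeasure μ]

/-- Swaps preserve the product measure, so the probability is the average over all swaps, and the
counting bound holds for each fixed `w`. -/
theorem measure_discrepantPairs_mul_le {F : Set (Ω → ℝ)} (hF : ∀ f ∈ F, LipschitzWith 1 f) {D : ℕ}
    (hD : vcDim (superlevelSets F) ≤ D) (M p : ℕ) :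
    (Measure.pi fun _ : ι => μ.prod μ) (discrepantPairs F ι M p) * 2 ^ p ≤
      (2 * (2 * Fintype.card ι + 1) ^ D + 1) ^ M := by
  classical
  set P := Measure.pi fun _ : ι => μ.prod μ
  set E := discrepantPairs F ι M p
  have hE : MeasurableSet E := (isOpen_discrepantPairs hF M p).measurableSet
  have hσ : ∀ σ : ι → Bool, P (swapPairs σ ⁻¹' E) = P E := fun σ =>
    (measurePreserving_swapPairs μ σ).measure_preimage hE.nullMeasurableSet
  have hm : ∀ σ : ι → Bool, MeasurableSet (swapPairs σ ⁻¹' E) := fun σ =>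
    (measurePreserving_swapPairs μ σ).measurable hE
  have h1 : (2 : ℝ≥0∞) ^ Fintype.card ι * P E =
      ∫⁻ w, ∑ σ : ι → Bool, (swapPairs σ ⁻¹' E).indicator 1 w ∂P := by
    rw [lintegral_finsetSum _ fun σ _ => measurable_one.indicator (hm σ)]
    simp_rw [lintegral_indicator_one (hm _), hσ]
    simp
  have h2 : ∀ w, (∑ σ : ι → Bool, (swapPairs σ ⁻¹' E).indicator (1 : (ι → Ω × Ω) → ℝ≥0∞) w) * 2 ^ p
      ≤ (2 * (2 * Fintype.card ι + 1) ^ D + 1) ^ M * 2 ^ Fintype.card ι := by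
    intro w
    have h3 : (∑ σ : ι → Bool, (swapPairs σ ⁻¹' E).indicator (1 : (ι → Ω × Ω) → ℝ≥0∞) w) =
        ((Finset.univ.filter fun σ : ι → Bool => swapPairs σ w ∈ E).card : ℝ≥0∞) := by
      simp only [indicator_apply, mem_preimage, Pi.one_apply]
      rw [Finset.sum_boole]
    rw [h3]
    exact_mod_cast card_swapPairs_mem_mul_le F hD M p w
  have h4 : P E * 2 ^ p * 2 ^ Fintype.card ι ≤
      (2 * (2 * Fintype.card ι + 1) ^ D + 1) ^ M * 2 ^ Fintype.card ι := by
    calc _ = (2 ^ Fintype.card ι * P E) * 2 ^ p := by ring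
      _ = ∫⁻ w, (∑ σ : ι → Bool, (swapPairs σ ⁻¹' E).indicator 1 w) * 2 ^ p ∂P := by
        rw [h1, lintegral_mul_const]
        exact Finset.measurable_fun_sum _ fun σ _ => measurable_one.indicator (hm σ)
      _ ≤ ∫⁻ _, (2 * (2 * Fintype.card ι + 1) ^ D + 1) ^ M * 2 ^ Fintype.card ι ∂P :=
        lintegral_mono h2
      _ = _ := by simp
  exact (ENNReal.mul_le_mul_iff_left (by simp) (by simp)).1 h4

/-- With high probability, no cell of small measure contains many points of a sample. -/
theorem measure_exists_cell_mul_le {F : Set (Ω → ℝ)} (hF : ∀ f ∈ F, LipschitzWith 1 f) {D : ℕ}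
    (hD : vcDim (superlevelSets F) ≤ D) (M p : ℕ) {β : ℝ≥0∞}
    (hβ : Fintype.card ι * β ≤ 2⁻¹) :
    (Measure.pi fun _ : ι => μ) {x | ∃ l : List (Ω → ℝ), (∀ g ∈ l, IsSigned F g) ∧ l.length ≤ M ∧
      μ (cell l) ≤ β ∧ ∃ s : Finset ι, p ≤ s.card ∧ ∀ i ∈ s, x i ∈ cell l} * 2 ^ p ≤
      2 * (2 * (2 * Fintype.card ι + 1) ^ D + 1) ^ M := by
  set ν := Measure.pi fun _ : ι => μ
  set e := MeasurableEquiv.arrowProdEquivProdArrow Ω Ω ι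
  have he : MeasurePreserving e (Measure.pi fun _ : ι => μ.prod μ) (ν.prod ν) :=
    measurePreserving_arrowProdEquivProdArrow Ω Ω ι (fun _ => μ) (fun _ => μ)
  set E := e.symm ⁻¹' discrepantPairs F ι M p
  have hE : MeasurableSet E := e.symm.measurable (isOpen_discrepantPairs hF M p).measurableSet
  have hPE : (ν.prod ν) E = (Measure.pi fun _ : ι => μ.prod μ) (discrepantPairs F ι M p) :=
    he.symm.measure_preimage (isOpen_discrepantPairs hF M p).measurableSet.nullMeasurableSet
  set Bad := {x : ι → Ω | ∃ l : List (Ω → ℝ), (∀ g ∈ l, IsSigned F g) ∧ l.length ≤ M ∧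
      μ (cell l) ≤ β ∧ ∃ s : Finset ι, p ≤ s.card ∧ ∀ i ∈ s, x i ∈ cell l}
  -- The union bound `hβ` makes a ghost sample miss the thin cell with probability at least 1/2.
  have hBad : Bad ⊆ {x | 2⁻¹ ≤ ν (Prod.mk x ⁻¹' E)} := by
    rintro x ⟨l, hl, hM, hlβ, s, hs, hsl⟩
    set H : Set (ι → Ω) := ⋃ i, Function.eval i ⁻¹' cell l
    have hcell : MeasurableSet (cell l) :=
      measurableSet_cell fun g hg => ((hl g hg).lipschitzWith hF).continuous.measurable
    have hHm : MeasurableSet H := MeasurableSet.iUnion fun i => measurable_pi_apply i hcell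
    have hH : ν H ≤ 2⁻¹ := by
      refine ((measure_iUnion_le _).trans ?_).trans hβ
      rw [tsum_fintype]
      have h1 : ∀ i : ι, ν (Function.eval i ⁻¹' cell l) ≤ β := fun i => by
        rw [(measurePreserving_eval (fun _ : ι => μ) i).measure_preimage hcell.nullMeasurableSet]
        exact hlβ
      calc _ ≤ ∑ i : ι, β := Finset.sum_le_sum fun i _ => h1 i
        _ = _ := by simp
    have hsub : Hᶜ ⊆ Prod.mk x ⁻¹' E := by
      intro y hy
      have hy' : ∀ i, ∃ g ∈ l, g (y i) < 0 := by
        intro i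
        by_contra! hcon
        exact hy (mem_iUnion.2 ⟨i, hcon⟩)
      choose g hg hgy using hy'
      -- Finitely many points outside the closed cell violate its conditions by a common margin.
      have hη : ∀ᶠ η : ℝ in 𝓝[>] 0, ∀ i, g i (y i) < -η := by
        refine Filter.eventually_all.2 fun i => ?_
        have : 0 < -g i (y i) := by linarith [hgy i]
        filter_upwards [Ioo_mem_nhdsGT this] with η hη
        linarith [hη.2]
      obtain ⟨η, hη, hη0⟩ := (hη.and self_mem_nhdsWithin).exists
      refine ⟨l, hl, hM, η, ⟨s, hs, fun i hi g' hg' => ?_⟩, fun i => ⟨g i, hg i, hη i⟩⟩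
      have h1 : 0 ≤ g' (x i) := hsl i hi g' hg'
      have h2 : 0 < η := hη0
      show -η < g' (x i)
      linarith
    calc (2⁻¹ : ℝ≥0∞) = 1 - 2⁻¹ := ENNReal.one_sub_inv_two.symm
      _ ≤ 1 - ν H := tsub_le_tsub_left hH _
      _ = ν Hᶜ := (prob_compl_eq_one_sub hHm).symm
      _ ≤ _ := measure_mono hsub
  -- Markov's inequality for the measurable superset of `Bad`; `Bad` itself need not be measurable.
  have h1 : 2⁻¹ * ν Bad ≤ (ν.prod ν) E := by
    rw [Measure.prod_apply hE]
    exact (mul_le_mul_right (measure_mono hBad) _).trans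
      (mul_meas_ge_le_lintegral (measurable_measure_prodMk_left hE) _)
  have h2 := measure_discrepantPairs_mul_le (ι := ι) μ hF hD M p
  rw [← hPE] at h2
  calc ν Bad * 2 ^ p = 2 * (2⁻¹ * ν Bad * 2 ^ p) := by
        rw [mul_assoc, ← mul_assoc 2, ENNReal.mul_inv_cancel (by simp) (by simp), one_mul]
    _ ≤ 2 * ((ν.prod ν) E * 2 ^ p) := by gcongr
    _ ≤ _ := by gcongr

/-- The points of a sample are distinct with high probability. -/
theorem measure_not_injective_le {β : ℝ≥0∞} (hβ : ∀ ω, μ {ω} ≤ β) :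
    (Measure.pi fun _ : ι => μ) {x | ¬ Function.Injective x} ≤ (Fintype.card ι : ℝ≥0∞) ^ 2 * β := by
  classical
  set ν := Measure.pi fun _ : ι => μ
  have hpair : ∀ i j : ι, i ≠ j → ν {x | x i = x j} ≤ β := by
    intro i j hij
    have hind : ProbabilityTheory.IndepFun (fun x : ι → Ω => x i) (fun x => x j) ν :=
      (ProbabilityTheory.iIndepFun_pi (μ := fun _ : ι => μ) (X := fun _ => id)
        fun _ => aemeasurable_id).indepFun hij
    have hmap := (ProbabilityTheory.indepFun_iff_map_prod_eq_prod_map_map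
      (measurable_pi_apply i).aemeasurable (measurable_pi_apply j).aemeasurable).1 hind
    rw [show ν.map (fun x => x i) = μ from (measurePreserving_eval (fun _ : ι => μ) i).map_eq,
      show ν.map (fun x => x j) = μ from (measurePreserving_eval (fun _ : ι => μ) j).map_eq] at hmap
    have hdiag : MeasurableSet (diagonal Ω) := isClosed_diagonal.measurableSet
    have h1 : ν {x | x i = x j} = (μ.prod μ) (diagonal Ω) := by
      rw [← hmap, Measure.map_apply (by fun_prop) hdiag]
      rfl
    rw [h1, Measure.prod_apply hdiag]
    calc ∫⁻ ω, μ (Prod.mk ω ⁻¹' diagonal Ω) ∂μ ≤ ∫⁻ _, β ∂μ := by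
          refine lintegral_mono fun ω => ?_
          rw [show Prod.mk ω ⁻¹' diagonal Ω = {ω} by ext; simp [eq_comm]]
          exact hβ ω
      _ = β := by simp
  have hsub : {x : ι → Ω | ¬ Function.Injective x} ⊆
      ⋃ q : ι × ι, {x | q.1 ≠ q.2 ∧ x q.1 = x q.2} := by
    intro x hx
    simp only [Function.Injective, mem_ofPred_eq] at hx
    push Not at hx
    obtain ⟨i, j, h, hne⟩ := hx
    exact mem_iUnion.2 ⟨(i, j), hne, h⟩
  refine ((measure_mono hsub).trans (measure_iUnion_le _)).trans ?_
  rw [tsum_fintype]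
  calc _ ≤ ∑ _q : ι × ι, β := by
        refine Finset.sum_le_sum fun q _ => ?_
        by_cases hq : q.1 = q.2
        · simp [hq]
        · simpa [hq] using hpair q.1 q.2 hq
    _ = _ := by simp [sq, Fintype.card_prod]

end GhostSample

/-! ### Small balls and the failure probability in a fixed dimension. -/

section FixedDimension

variable {Ω : Type*} [MetricSpace Ω] [MeasurableSpace Ω] [BorelSpace Ω]
  {μ : Measure Ω} [IsProbabilityMeasure μ]

/-- In a space with gaussian concentration, if a point has a neighbourhood of measure at least one
half, the mean distance to this point is not much larger than the radius. -/
theorem lintegral_dist_le {C a r : ℝ} (hC : 0 ≤ C) (ha : 0 < a)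
    (hconc : ∀ ε : ℝ, 0 ≤ ε → concentrationFunction μ ε ≤ C * Real.exp (-(a * ε ^ 2)))
    (hr : 0 ≤ r) {ω : Ω} (hω : 1 / 2 ≤ μ.real (Metric.ball ω r)) :
    ∫⁻ x, ENNReal.ofReal (dist ω x) ∂μ ≤ ENNReal.ofReal (r + C * (√(Real.pi / a) / 2)) := by
  set f : Ω → ℝ := fun x => max (dist ω x - r) 0
  have hfc : Continuous f := by fun_prop
  -- Points at distance at least `r + t` from `ω` lie outside the `t`-neighbourhood of the ball.
  -- Integrating this tail gives the Gaussian integral below.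
  have htail : ∀ t ∈ Ioi (0 : ℝ), μ {x | t ≤ f x} ≤ ENNReal.ofReal (C * Real.exp (-a * t ^ 2)) := by
    intro t ht
    have ht0 : 0 < t := ht
    have h1 := one_sub_le_measureReal_thickening ht0 (hconc t ht0.le)
      (Metric.isOpen_ball.measurableSet) hω
    have h2 : {x | t ≤ f x} ⊆ (Metric.thickening t (Metric.ball ω r))ᶜ := by
      intro x hx hxt
      obtain ⟨y, hy, hxy⟩ := Metric.mem_thickening_iff.1 hxt
      have h3 := dist_triangle ω y x
      rw [Metric.mem_ball, dist_comm] at hy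
      rw [dist_comm] at hxy
      have h4 : t ≤ max (dist ω x - r) 0 := hx
      rcases le_max_iff.1 h4 with h | h <;> linarith
    have h3 := measureReal_mono (μ := μ) h2
    rw [probReal_compl_eq_one_sub Metric.isOpen_thickening.measurableSet] at h3
    rw [← ofReal_measureReal (μ := μ)]
    refine ENNReal.ofReal_le_ofReal ?_
    rw [neg_mul]
    linarith
  have hf : ∫⁻ x, ENNReal.ofReal (f x) ∂μ ≤ ENNReal.ofReal (C * (√(Real.pi / a) / 2)) := by
    rw [lintegral_eq_lintegral_meas_le μ (f := f) (Eventually.of_forall fun x => le_max_right _ _)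
      hfc.measurable.aemeasurable, ← integral_gaussian_Ioi, ← integral_const_mul,
      ofReal_integral_eq_lintegral_ofReal]
    · exact setLIntegral_mono' measurableSet_Ioi htail
    · exact ((integrable_exp_neg_mul_sq ha).const_mul C).integrableOn
    · exact Eventually.of_forall fun t => mul_nonneg hC (Real.exp_pos _).le
  calc ∫⁻ x, ENNReal.ofReal (dist ω x) ∂μ
      ≤ ∫⁻ x, ENNReal.ofReal r + ENNReal.ofReal (f x) ∂μ := by
        refine lintegral_mono fun x => ?_
        rw [← ENNReal.ofReal_add hr (le_max_right _ _)]
        refine ENNReal.ofReal_le_ofReal ?_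
        have := le_max_left (dist ω x - r) 0
        show dist ω x ≤ r + max (dist ω x - r) 0
        linarith
    _ = ENNReal.ofReal r + ∫⁻ x, ENNReal.ofReal (f x) ∂μ := by
        rw [lintegral_add_left measurable_const]; simp
    _ ≤ _ := by
        rw [ENNReal.ofReal_add hr (by positivity)]
        gcongr

variable [SecondCountableTopology Ω]

/-- In a space with gaussian concentration and mean distance `1`, small balls have exponentially
small measure. -/
theorem measureReal_ball_le {C a : ℝ} (hC : 0 ≤ C) (ha : 0 < a)
    (hconc : ∀ ε : ℝ, 0 ≤ ε → concentrationFunction μ ε ≤ C * Real.exp (-(a * ε ^ 2)))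
    (hdist : ∫ p, dist p.1 p.2 ∂(μ.prod μ) = 1) (hsmall : C * (√(Real.pi / a) / 2) ≤ 1 / 8)
    (ω : Ω) : μ.real (Metric.ball ω (1 / 8)) ≤ C * Real.exp (-(a * (1 / 16) ^ 2)) := by
  by_contra! hlt
  -- If the ball is too large, the ball of radius 3/16 has measure at least 1/2. The mean distance
  -- to `ω` is then at most 3/16 + 1/8 = 5/16, and the mean distance of two points at most 5/8, less
  -- than 1.
  have h1 := half_le_measureReal_thickening (by norm_num) (hconc (1 / 16) (by norm_num))
    Metric.isOpen_ball.measurableSet hlt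
  have h2 : 1 / 2 ≤ μ.real (Metric.ball ω (3 / 16)) := by
    refine h1.trans (measureReal_mono fun x hx => ?_)
    obtain ⟨y, hy, hxy⟩ := Metric.mem_thickening_iff.1 hx
    have h3 := dist_triangle x y ω
    rw [Metric.mem_ball] at hy ⊢
    linarith
  have h3 := lintegral_dist_le hC ha hconc (by norm_num) h2
  have h4 : ∫⁻ x, ENNReal.ofReal (dist ω x) ∂μ ≤ ENNReal.ofReal (5 / 16) :=
    h3.trans (ENNReal.ofReal_le_ofReal (by linarith))
  have h5 : ∫⁻ p, ENNReal.ofReal (dist p.1 p.2) ∂(μ.prod μ) ≤ ENNReal.ofReal (5 / 8) := by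
    calc ∫⁻ p, ENNReal.ofReal (dist p.1 p.2) ∂(μ.prod μ)
        ≤ ∫⁻ p, ENNReal.ofReal (dist ω p.1) + ENNReal.ofReal (dist ω p.2) ∂(μ.prod μ) := by
          refine lintegral_mono fun p => ?_
          rw [← ENNReal.ofReal_add dist_nonneg dist_nonneg]
          exact ENNReal.ofReal_le_ofReal (dist_triangle_left _ _ _)
      _ = ∫⁻ x, ENNReal.ofReal (dist ω x) ∂μ + ∫⁻ x, ENNReal.ofReal (dist ω x) ∂μ := by
          have hm : Measurable fun x : Ω => ENNReal.ofReal (dist ω x) := by fun_prop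
          rw [lintegral_add_left
            (by fun_prop : Measurable fun p : Ω × Ω => ENNReal.ofReal (dist ω p.1))]
          exact congrArg₂ _ ((measurePreserving_fst (μ := μ) (ν := μ)).lintegral_comp hm)
            ((measurePreserving_snd (μ := μ) (ν := μ)).lintegral_comp hm)
      _ ≤ ENNReal.ofReal (5 / 16) + ENNReal.ofReal (5 / 16) := add_le_add h4 h4
      _ = ENNReal.ofReal (5 / 8) := by
          rw [← ENNReal.ofReal_add (by norm_num) (by norm_num)]; norm_num
  rw [integral_eq_lintegral_of_nonneg_ae (Eventually.of_forall fun p => dist_nonneg)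
    (by fun_prop)] at hdist
  have h6 := ENNReal.toReal_mono ENNReal.ofReal_ne_top h5
  rw [hdist, ENNReal.toReal_ofReal (by norm_num)] at h6
  norm_num at h6

/-- The outer probability of a sample that admits a metric tree of low expected cost. -/
theorem measure_exists_tree_le {F : Set (Ω → ℝ)} (hF : ∀ f ∈ F, LipschitzWith 1 f) {D : ℕ}
    (hD : vcDim (superlevelSets F) ≤ D) {ε b : ℝ} {n p Q : ℕ} (hb0 : 0 ≤ b)
    (hfat : ∀ S, MeasurableSet S → b < μ.real S → 1 - b ≤ μ.real (Metric.thickening ε S))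
    (hε : 0 < ε) (hball : ∀ ω, μ.real (Metric.ball ω ε) ≤ b) (hnb : (n + 1) * b ≤ 1 / 2)
    (hpQ : 2 * Q + p * (2 * Q + 1) < n) :
    Measure.pi (fun _ : Fin n => μ) {x | ¬ ∀ T : IndexTree Ω, T.IsMetricTree F →
      (Q : ℝ≥0∞) ≤ T.avgNNCost μ (range x)} ≤
      (n : ℝ≥0∞) ^ 2 * ENNReal.ofReal b +
        2 * (2 * (2 * n + 1) ^ D + 1) ^ (2 * Q) / 2 ^ (p + 1) := by
  have hreal : ∀ S : Set Ω, μ S = ENNReal.ofReal (μ.real S) := fun S => (ofReal_measureReal (μ := μ)).symm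
  -- An atom lies in a small ball. Distinctness matters because the dataset is the set `range x`, in
  -- which repeated points would be lost.
  have hinj := measure_not_injective_le (ι := Fin n) μ (β := ENNReal.ofReal b) fun ω => by
    rw [hreal]
    exact ENNReal.ofReal_le_ofReal ((measureReal_mono
      (singleton_subset_iff.2 (Metric.mem_ball_self hε))).trans (hball ω))
  -- More than `p` points means at least `p + 1`, hence the power `2 ^ (p + 1)`.
  have hcell := measure_exists_cell_mul_le (ι := Fin n) μ hF hD (2 * Q) (p + 1)
    (β := ENNReal.ofReal b) (by
      rw [Fintype.card_fin, ← ENNReal.ofReal_natCast, ← ENNReal.ofReal_mul (by positivity)]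
      refine (ENNReal.ofReal_le_ofReal (q := 2⁻¹) (by linarith)).trans ?_
      rw [ENNReal.ofReal_inv_of_pos (by norm_num)]; simp)
  rw [Fintype.card_fin] at hinj hcell
  set ν := Measure.pi fun _ : Fin n => μ
  refine le_trans (measure_mono ?_) ((measure_union_le _ _).trans
    (add_le_add hinj ((ENNReal.le_div_iff_mul_le (by simp) (by simp)).2 hcell)))
  intro x hx
  by_contra hgood
  rw [mem_union, not_or] at hgood
  obtain ⟨hxinj, hxcell⟩ := hgood
  have hxinj : Function.Injective x := not_not.1 hxinj
  refine hx fun T hT => ?_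
  have hn : 0 < n := by omega
  have : Nonempty (Fin n) := ⟨⟨0, hn⟩⟩
  have hncard : (range x).ncard = n := by
    rw [← image_univ, ncard_image_of_injective _ hxinj]; simp
  refine IndexTree.le_avgNNCost hF (finite_range x) (ε := ε) (β := ENNReal.ofReal b) (p := p)
    ?_ ?_ (by rwa [hncard]) hT
  · intro S hS hSb
    rw [hreal S] at hSb
    have h1 := hfat S hS (ENNReal.ofReal_lt_ofReal_iff'.1 hSb).1
    set G : Set Ω := {ω | ε ≤ Metric.infDist ω (range x)}
    have hG : MeasurableSet G :=
      measurableSet_le measurable_const (Metric.continuous_infDist_pt _).measurable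
    have h2 : μ.real Gᶜ ≤ n * b := by
      have h3 : Gᶜ ⊆ ⋃ i, Metric.ball (x i) ε := by
        intro ω hω
        have h4 : Metric.infDist ω (range x) < ε := not_le.1 hω
        obtain ⟨_, ⟨i, rfl⟩, hi⟩ := (Metric.infDist_lt_iff (range_nonempty x)).1 h4
        exact mem_iUnion.2 ⟨i, hi⟩
      refine (measureReal_mono h3).trans ((measureReal_iUnion_fintype_le _).trans ?_)
      refine (Finset.sum_le_sum fun i _ => hball (x i)).trans ?_
      simp
    have h5 : Metric.thickening ε S ⊆ (Metric.thickening ε S ∩ G) ∪ Gᶜ := by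
      intro ω hω
      by_cases h : ω ∈ G
      · exact Or.inl ⟨hω, h⟩
      · exact Or.inr h
    have h6 := (measureReal_mono (μ := μ) h5).trans (measureReal_union_le _ _)
    rw [hreal]
    refine le_trans ?_ (ENNReal.ofReal_le_ofReal (p := 2⁻¹) (by linarith))
    rw [ENNReal.ofReal_inv_of_pos (by norm_num)]; simp
  · intro l hl hM hlb
    classical
    by_contra! hlt
    refine hxcell ⟨l, hl, hM, hlb, Finset.univ.filter fun i => x i ∈ cell l, ?_, by simp⟩
    have h1 : range x ∩ cell l = x '' (Finset.univ.filter fun i => x i ∈ cell l : Finset (Fin n)) := by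
      ext ω
      constructor
      · rintro ⟨⟨i, rfl⟩, hi⟩
        exact ⟨i, by simpa using hi, rfl⟩
      · rintro ⟨i, hi, rfl⟩
        exact ⟨⟨i, rfl⟩, by simpa using hi⟩
    rw [h1, ncard_image_of_injective _ hxinj, ncard_coe_finset] at hlt
    exact hlt

end FixedDimension

/-! ### Choice of parameters and growth estimates. -/

section Asymptotics

/-- The crude bound `n + 1 ≤ 2 ^ (2 * r)` with `r = Nat.sqrt n` replaces logarithms. The required
exponent is then linear in `r`; times `8 * Q` it is at most `W * r ≤ r * r ≤ n`. -/
theorem four_mul_sq_mul_pow_le {n d D Q p : ℕ} (hQ : 0 < Q) (hn : n < 8 * Q * (p + 1))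
    (hW : (8 * Q * (6 * Q * (D + 1) + 2 + 2 * d)) ^ 2 ≤ n) :
    4 * d ^ 2 * (2 * (2 * n + 1) ^ D + 1) ^ (2 * Q) ≤ 2 ^ (p + 1) := by
  set W := 8 * Q * (6 * Q * (D + 1) + 2 + 2 * d) with hWdef
  set r := Nat.sqrt n
  have hWr : W ≤ r := Nat.le_sqrt'.2 hW
  have hr1 : 1 ≤ r := le_trans (Nat.succ_le_of_lt (by positivity)) hWr
  have hrn : r * r ≤ n := Nat.sqrt_le n
  have hnr : n + 1 ≤ 2 ^ (2 * r) := by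
    have h1 : n < (r + 1) * (r + 1) := Nat.lt_succ_sqrt n
    have h2 : r + 1 ≤ 2 ^ r := Nat.lt_two_pow_self
    calc n + 1 ≤ (r + 1) * (r + 1) := h1
      _ ≤ 2 ^ r * 2 ^ r := Nat.mul_le_mul h2 h2
      _ = _ := by rw [← pow_add]; ring_nf
  have h2n : 2 * n + 1 ≤ 2 ^ (2 * r + 1) := by rw [pow_succ]; omega
  have hn1 : 1 ≤ n := le_trans (Nat.mul_pos hr1 hr1) hrn
  have hB : 2 * (2 * n + 1) ^ D + 1 ≤ 2 ^ ((2 * r + 1) * (D + 1)) := by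
    have h1 : 1 ≤ (2 * n + 1) ^ D := Nat.one_le_pow _ _ (by omega)
    calc 2 * (2 * n + 1) ^ D + 1 ≤ (2 * n + 1) ^ D * 3 := by omega
      _ ≤ (2 * n + 1) ^ D * (2 * n + 1) := Nat.mul_le_mul_left _ (by omega)
      _ = (2 * n + 1) ^ (D + 1) := (pow_succ _ _).symm
      _ ≤ (2 ^ (2 * r + 1)) ^ (D + 1) := Nat.pow_le_pow_left h2n _
      _ = _ := (pow_mul _ _ _).symm
  have hd : 4 * d ^ 2 ≤ 2 ^ (2 + 2 * d) := by
    have h1 : d ≤ 2 ^ d := Nat.lt_two_pow_self.le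
    calc 4 * d ^ 2 ≤ 4 * (2 ^ d) ^ 2 := by gcongr
      _ = _ := by rw [← pow_mul, pow_add]; ring_nf
  have hexp : 2 + 2 * d + (2 * r + 1) * (D + 1) * (2 * Q) ≤ p + 1 := by
    have h1 : 8 * Q * (2 + 2 * d + (2 * r + 1) * (D + 1) * (2 * Q)) ≤ n := by
      calc 8 * Q * (2 + 2 * d + (2 * r + 1) * (D + 1) * (2 * Q))
          ≤ 8 * Q * ((2 + 2 * d) * r + (2 * r + r) * (D + 1) * (2 * Q)) := by
            gcongr
            exact Nat.le_mul_of_pos_right _ hr1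
        _ = W * r := by rw [hWdef]; ring
        _ ≤ r * r := Nat.mul_le_mul_right _ hWr
        _ ≤ n := hrn
    exact (lt_of_mul_lt_mul_left (h1.trans_lt hn) (Nat.zero_le _)).le
  calc 4 * d ^ 2 * (2 * (2 * n + 1) ^ D + 1) ^ (2 * Q)
      ≤ 2 ^ (2 + 2 * d) * (2 ^ ((2 * r + 1) * (D + 1))) ^ (2 * Q) :=
        Nat.mul_le_mul hd (Nat.pow_le_pow_left hB _)
    _ = 2 ^ (2 + 2 * d + (2 * r + 1) * (D + 1) * (2 * Q)) := by rw [← pow_mul, ← pow_add]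
    _ ≤ _ := Nat.pow_le_pow_right (by norm_num) hexp

theorem two_mul_add_lt_of_sq_le {n d D Q p : ℕ} (hQ : 0 < Q) (hp : p * (8 * Q) ≤ n)
    (hW : (8 * Q * (6 * Q * (D + 1) + 2 + 2 * d)) ^ 2 ≤ n) :
    2 * Q + p * (2 * Q + 1) < n := by
  have h1 : 16 * Q ≤ 8 * Q * (6 * Q * (D + 1) + 2 + 2 * d) := by
    nlinarith [Nat.zero_le (Q * (6 * Q * (D + 1) + 2 * d))]
  have h2 : 16 * Q ≤ n := h1.trans ((Nat.le_self_pow (by norm_num) _).trans hW)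
  have h3 : p * (2 * Q + 1) ≤ p * (3 * Q) := Nat.mul_le_mul_left _ (by omega)
  have h4 : p * (8 * Q) = 8 * (p * Q) := by ring
  have h5 : p * (3 * Q) = 3 * (p * Q) := by ring
  omega

theorem eventually_sq_le {n : ℕ → ℕ} (hsuper : ∀ k : ℕ, ∀ᶠ d : ℕ in atTop, d ^ k ≤ n d)
    (k K : ℕ) : ∀ᶠ d : ℕ in atTop,
      (8 * d ^ k * (6 * d ^ k * (d ^ K + 1) + 2 + 2 * d)) ^ 2 ≤ n d := by
  filter_upwards [hsuper ((2 * k + K + 2) * 2), eventually_ge_atTop 128] with d hd h128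
  refine le_trans ?_ hd
  rw [pow_mul]
  gcongr
  have hK : 1 ≤ d ^ K := Nat.one_le_pow _ _ (by omega)
  have hk : 1 ≤ d ^ k := Nat.one_le_pow _ _ (by omega)
  have hkK : 1 ≤ d ^ k * d ^ K := Nat.mul_pos hk hK
  have h1 : d ≤ d ^ k * d ^ K * d := Nat.le_mul_of_pos_left _ hkK
  have h2 : d ^ k * d ^ K ≤ d ^ k * d ^ K * d := Nat.le_mul_of_pos_right _ (by omega)
  have h3 : d ^ k ≤ d ^ k * d ^ K := Nat.le_mul_of_pos_right _ hK
  calc 8 * d ^ k * (6 * d ^ k * (d ^ K + 1) + 2 + 2 * d)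
      = 8 * d ^ k * (6 * (d ^ k * d ^ K) + 6 * d ^ k + 2 + 2 * d) := by ring
    _ ≤ 8 * d ^ k * (16 * (d ^ k * d ^ K * d)) := by gcongr; omega
    _ = 128 * (d ^ k * d ^ k * d ^ K * d) := by ring
    _ ≤ d * (d ^ k * d ^ k * d ^ K * d) := by gcongr
    _ = d ^ (2 * k + K + 2) := by ring

theorem eventually_sq_mul_exp_le {n : ℕ → ℕ}
    (hsub : (fun d : ℕ => Real.log (n d)) =o[atTop] (fun d : ℕ => (d : ℝ)))
    (hpos : ∀ᶠ d in atTop, 0 < n d) {C a : ℝ} (hC : 0 < C) (ha : 0 < a) :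
    ∀ᶠ d : ℕ in atTop, (n d : ℝ) ^ 2 * (C * Real.exp (-(a * d))) ≤ 1 / (2 * d ^ 2) := by
  have h1 := hsub.bound (show (0 : ℝ) < a / 4 by positivity)
  have h2 : ∀ᶠ d : ℕ in atTop, ‖(d : ℝ) ^ 2‖ ≤ 1 / (2 * C) * ‖Real.exp (a / 2 * d)‖ :=
    ((isLittleO_pow_exp_pos_mul_atTop 2 (half_pos ha)).comp_tendsto
      tendsto_natCast_atTop_atTop).bound (by positivity)
  -- The exponents balance: `n ^ 2` costs `a / 2`, `d ^ 2` costs another `a / 2`, and the decay is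
  -- `a`.
  filter_upwards [h1, h2, hpos, eventually_gt_atTop 0] with d h1 h2 hn hd
  have hd' : (0 : ℝ) < d := by exact_mod_cast hd
  have hn' : (0 : ℝ) < n d := by exact_mod_cast hn
  rw [Real.norm_eq_abs, Real.norm_eq_abs, abs_of_pos hd'] at h1
  rw [Real.norm_of_nonneg (by positivity), Real.norm_of_nonneg (by positivity)] at h2
  have h3 : (n d : ℝ) ≤ Real.exp (a / 4 * d) :=
    (Real.log_le_iff_le_exp hn').1 ((le_abs_self _).trans h1)
  rw [le_div_iff₀ (by positivity)]
  calc (n d : ℝ) ^ 2 * (C * Real.exp (-(a * d))) * (2 * d ^ 2)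
      ≤ Real.exp (a / 4 * d) ^ 2 * (C * Real.exp (-(a * d))) *
        (2 * (1 / (2 * C) * Real.exp (a / 2 * d))) := by gcongr
    _ = (C * (1 / (2 * C)) * 2) * (Real.exp (a / 4 * d) * Real.exp (a / 4 * d) *
        Real.exp (-(a * d)) * Real.exp (a / 2 * d)) := by ring
    _ = 1 := by
        rw [← Real.exp_add, ← Real.exp_add, ← Real.exp_add,
          show a / 4 * d + a / 4 * d + -(a * d) + a / 2 * d = 0 by ring, Real.exp_zero]
        field_simp

/-- A diagonal choice. -/
theorem exists_tendsto_atTop_of_forall_eventually {P : ℕ → ℕ → Prop}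
    (hP : ∀ k, ∀ᶠ d in atTop, P k d) :
    ∃ h : ℕ → ℕ, Tendsto h atTop atTop ∧ ∀ᶠ d in atTop, P (h d) d := by
  classical
  choose N hN using fun k => eventually_atTop.1 (hP k)
  -- The default value 0 of `Nat.findGreatest` is legitimate once `N 0 ≤ d`.
  refine ⟨fun d => Nat.findGreatest (fun k => N k ≤ d) d, ?_, ?_⟩
  · refine tendsto_atTop.2 fun k => ?_
    filter_upwards [eventually_ge_atTop k, eventually_ge_atTop (N k)] with d hk hNk
    exact Nat.le_findGreatest hk hNk
  · filter_upwards [eventually_ge_atTop (N 0)] with d hd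
    exact hN _ _ (Nat.findGreatest_spec (P := fun k => N k ≤ d) (Nat.zero_le d) hd)

end Asymptotics

/-! ### A summable failure bound for each exponent, and the main theorem. -/

theorem eventually_measure_exists_tree_le
    (Ω : ℕ → Type*) [∀ d, MetricSpace (Ω d)] [∀ d, TopologicalSpace.SeparableSpace (Ω d)]
    [∀ d, MeasurableSpace (Ω d)] [∀ d, BorelSpace (Ω d)]
    (μ : ∀ d, Measure (Ω d)) [∀ d, IsProbabilityMeasure (μ d)]
    (hconc : ∃ C c : ℝ, 0 < c ∧ ∀ᶠ d : ℕ in atTop, ∀ ε : ℝ, 0 ≤ ε →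
      concentrationFunction (μ d) ε ≤ C * Real.exp (-(c * ε ^ 2 * d)))
    (hdist : ∀ᶠ d : ℕ in atTop, ∫ p, dist p.1 p.2 ∂((μ d).prod (μ d)) = 1)
    (F : ∀ d, Set (Ω d → ℝ)) (hF : ∀ d, ∀ f ∈ F d, LipschitzWith 1 f)
    (hVC : ∃ k : ℕ, ∀ᶠ d : ℕ in atTop, vcDim (superlevelSets (F d)) ≤ ((d ^ k : ℕ) : ℕ∞))
    (n : ℕ → ℕ) (hsuper : ∀ k : ℕ, ∀ᶠ d : ℕ in atTop, d ^ k ≤ n d)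
    (hsub : (fun d : ℕ => Real.log (n d)) =o[atTop] (fun d : ℕ => (d : ℝ))) (k : ℕ) :
    ∀ᶠ d : ℕ in atTop, Measure.pi (fun _ : Fin (n d) => μ d)
      {x | ¬ ∀ T : IndexTree (Ω d), T.IsMetricTree (F d) →
        (d : ℝ≥0∞) ^ k ≤ T.avgNNCost (μ d) (range x)} ≤ ENNReal.ofReal (1 / d ^ 2) := by
  obtain ⟨C, c, hc, hconc⟩ := hconc
  obtain ⟨K, hVC⟩ := hVC
  -- The value 1/2 of the concentration function at 0 forces `1 / 2 ≤ C`.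
  have hC : 0 < C := by
    obtain ⟨d, hd⟩ := hconc.exists
    have h := hd 0 le_rfl
    simp only [concentrationFunction, if_true] at h
    norm_num at h
    linarith
  have hn : ∀ᶠ d in atTop, 0 < n d := by
    filter_upwards [hsuper 0] with d hd
    rw [pow_zero] at hd
    exact hd
  have hsmall : ∀ᶠ d : ℕ in atTop, C * (√(Real.pi / (c * d)) / 2) ≤ 1 / 8 := by
    have h1 : Tendsto (fun d : ℕ => Real.pi / (c * d)) atTop (𝓝 0) :=
      tendsto_const_nhds.div_atTop (tendsto_natCast_atTop_atTop.const_mul_atTop hc)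
    have h2 := ((Real.continuous_sqrt.tendsto 0).comp h1).div_const 2 |>.const_mul C
    simp only [Real.sqrt_zero, zero_div, mul_zero] at h2
    exact h2.eventually_le_const (by norm_num)
  filter_upwards [hconc, hdist, hVC, hn, hsmall, eventually_sq_le hsuper k K,
    eventually_sq_mul_exp_le hsub hn hC (show 0 < c / 256 by positivity), eventually_ge_atTop 2]
    with d hconc hdist hVC hn hsmall hW hexp hd
  have : SecondCountableTopology (Ω d) := UniformSpace.secondCountable_of_separable _
  have hd' : (2 : ℝ) ≤ d := by exact_mod_cast hd
  have hn' : (1 : ℝ) ≤ n d := by exact_mod_cast hn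
  have ha : 0 < c * d := by positivity
  have hconc' : ∀ ε : ℝ, 0 ≤ ε →
      concentrationFunction (μ d) ε ≤ C * Real.exp (-(c * d * ε ^ 2)) := fun ε hε => by
    rw [mul_right_comm]; exact hconc ε hε
  have hball := measureReal_ball_le hC.le ha hconc' hdist hsmall
  set b := C * Real.exp (-(c * d * (1 / 16) ^ 2)) with hb
  have hexp : (n d : ℝ) ^ 2 * b ≤ 1 / (2 * d ^ 2) := by
    rwa [hb, show c * d * (1 / 16 : ℝ) ^ 2 = c / 256 * d by ring]
  have hb0 : 0 ≤ b := by positivity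
  have hnb : (n d + 1 : ℝ) * b ≤ 1 / 2 := by
    have h1 : (n d + 1 : ℝ) ≤ 2 * n d ^ 2 := by nlinarith
    have h2 : (1 : ℝ) / (2 * d ^ 2) ≤ 1 / (2 * 2 ^ 2) := by gcongr
    have h3 := mul_le_mul_of_nonneg_right h1 hb0
    linarith
  have hQ : 0 < d ^ k := by positivity
  -- With `Q = d ^ k`, at most `2 * Q` thin cells with `p` points each hold about `n / 4` points,
  -- well below `n`, while `p` stays superpolynomial.
  set p := n d / (8 * d ^ k)
  have hp : p * (8 * d ^ k) ≤ n d := Nat.div_mul_le_self _ _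
  have hp' : n d < 8 * d ^ k * (p + 1) := Nat.lt_mul_div_succ _ (by positivity)
  have hmain := measure_exists_tree_le (hF d) hVC hb0 (fun S hS hSb => by
      have h := one_sub_le_measureReal_thickening_of_lt (by norm_num)
        (hconc' (1 / 16) (by norm_num)) hS hSb
      rwa [show (1 / 16 + 1 / 16 : ℝ) = 1 / 8 by norm_num] at h)
    (by norm_num) hball hnb (two_mul_add_lt_of_sq_le hQ hp hW)
  rw [Nat.cast_pow] at hmain
  refine hmain.trans ?_
  have hsplit : (1 : ℝ) / d ^ 2 = 1 / (2 * d ^ 2) + 1 / (2 * d ^ 2) := by field_simp; norm_num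
  rw [hsplit, ENNReal.ofReal_add (by positivity) (by positivity)]
  gcongr
  · rw [← ENNReal.ofReal_natCast, ← ENNReal.ofReal_pow (by positivity),
      ← ENNReal.ofReal_mul (by positivity)]
    exact ENNReal.ofReal_le_ofReal hexp
  · refine ENNReal.div_le_of_le_mul ?_
    have h1 := four_mul_sq_mul_pow_le hQ hp' hW
    set A := (2 * (2 * n d + 1) ^ d ^ K + 1) ^ (2 * d ^ k) with hA
    have h2 : (2 * (2 * (2 * (n d : ℝ≥0∞) + 1) ^ d ^ K + 1) ^ (2 * d ^ k)) =
        ENNReal.ofReal (2 * (A : ℝ)) := by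
      rw [ENNReal.ofReal_mul (by norm_num), ENNReal.ofReal_natCast, hA]
      push_cast
      simp
    have h3 : (2 : ℝ≥0∞) ^ (p + 1) = ENNReal.ofReal (2 ^ (p + 1)) := by
      rw [ENNReal.ofReal_pow (by norm_num)]; simp
    rw [h2, h3, ← ENNReal.ofReal_mul (by positivity)]
    refine ENNReal.ofReal_le_ofReal ?_
    have h4 : (4 : ℝ) * d ^ 2 * A ≤ 2 ^ (p + 1) := by exact_mod_cast h1
    rw [one_div, inv_mul_eq_div, le_div_iff₀ (by positivity)]
    linarith

end SimSearch

theorem mainTheorem1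
    (Ω : ℕ → Type*) [∀ d, MetricSpace (Ω d)] [∀ d, TopologicalSpace.SeparableSpace (Ω d)]
    [∀ d, MeasurableSpace (Ω d)] [∀ d, BorelSpace (Ω d)]
    (μ : ∀ d, Measure (Ω d)) [∀ d, IsProbabilityMeasure (μ d)]
    -- the concentration function is gaussian with exponent of order `ε ^ 2 * d`
    (hconc : ∃ C c : ℝ, 0 < c ∧ ∀ᶠ d : ℕ in atTop, ∀ ε : ℝ, 0 ≤ ε →
      SimSearch.concentrationFunction (μ d) ε ≤ C * Real.exp (-(c * ε ^ 2 * d)))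
    -- the expected distance between two points is `1`
    (hdist : ∀ᶠ d : ℕ in atTop, ∫ p, dist p.1 p.2 ∂((μ d).prod (μ d)) = 1)
    -- the class of decision functions
    (F : ∀ d, Set (Ω d → ℝ)) (hF : ∀ d, ∀ f ∈ F d, LipschitzWith 1 f)
    (hVC : ∃ k : ℕ, ∀ᶠ d : ℕ in atTop,
      SimSearch.vcDim (SimSearch.superlevelSets (F d)) ≤ ((d ^ k : ℕ) : ℕ∞))
    -- the number of datapoints is superpolynomial and subexponential in `d`
    (n : ℕ → ℕ) (hsuper : ∀ k : ℕ, ∀ᶠ d : ℕ in atTop, d ^ k ≤ n d)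
    (hsub : (fun d : ℕ => Real.log (n d)) =o[atTop] (fun d : ℕ => (d : ℝ))) :
    ∃ h : ℕ → ℕ, Tendsto h atTop atTop ∧
      -- the probability of a bad sample tends to `0`
      Tendsto (fun d : ℕ => Measure.pi (fun _ : Fin (n d) => μ d)
        {x | ¬ ∀ T : SimSearch.IndexTree (Ω d), T.IsMetricTree (F d) →
          (d : ℝ≥0∞) ^ h d ≤ T.avgNNCost (μ d) (range x)}) atTop (𝓝 0) ∧
      -- almost every infinite path of independent samples is eventually good
      ∀ᵐ x ∂(Measure.infinitePi fun d : ℕ => Measure.pi (fun _ : Fin (n d) => μ d)),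
        ∀ᶠ d : ℕ in atTop, ∀ T : SimSearch.IndexTree (Ω d), T.IsMetricTree (F d) →
          (d : ℝ≥0∞) ^ h d ≤ T.avgNNCost (μ d) (range (x d)) := by
  obtain ⟨h, hh, hbad⟩ := SimSearch.exists_tendsto_atTop_of_forall_eventually
    (SimSearch.eventually_measure_exists_tree_le Ω μ hconc hdist F hF hVC n hsuper hsub)
  have hsum : Summable fun d : ℕ => (1 : ℝ) / d ^ 2 := Real.summable_one_div_nat_pow.2 one_lt_two
  refine ⟨h, hh, ?_, ?_⟩
  · refine tendsto_of_tendsto_of_tendsto_of_le_of_le' tendsto_const_nhds ?_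
      (Eventually.of_forall fun _ => zero_le) hbad
    simpa using ENNReal.tendsto_ofReal hsum.tendsto_atTop_zero
  · obtain ⟨N, hN⟩ := eventually_atTop.1 hbad
    set ν := fun d : ℕ => Measure.pi (fun _ : Fin (n d) => μ d)
    set S : ∀ d, Set (Fin (n d) → Ω d) := fun d => {x | ¬ ∀ T : SimSearch.IndexTree (Ω d),
      T.IsMetricTree (F d) → (d : ℝ≥0∞) ^ h d ≤ T.avgNNCost (μ d) (range x)}
    have hle : ∀ d, N ≤ d → Measure.infinitePi ν (Function.eval d ⁻¹' S d) ≤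
        ENNReal.ofReal (1 / d ^ 2) := by
      intro d hd
      -- The bad set need not be measurable, so it is replaced by a measurable hull of the same
      -- outer measure before projecting.
      refine (measure_mono (preimage_mono (subset_toMeasurable (ν d) (S d)))).trans ?_
      rw [(measurePreserving_eval_infinitePi ν d).measure_preimage
        (measurableSet_toMeasurable _ _).nullMeasurableSet, measure_toMeasurable]
      exact hN d hd
    -- Borel-Cantelli; the condition `N ≤ d` discards the dimensions without a bound.
    have hfreq := measure_setOfPred_frequently_eq_zero (μ := Measure.infinitePi ν)
      (p := fun d x => N ≤ d ∧ x d ∈ S d) (by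
        refine ne_top_of_le_ne_top hsum.tsum_ofReal_ne_top (ENNReal.tsum_le_tsum fun d => ?_)
        by_cases hd : N ≤ d
        · exact (measure_mono fun x hx => hx.2).trans (hle d hd)
        · simp [hd])
    refine (ae_iff.2 (by simpa only [not_not] using hfreq) :
      ∀ᵐ x ∂Measure.infinitePi ν, ¬ ∃ᶠ d in atTop, N ≤ d ∧ x d ∈ S d).mono fun x hx => ?_
    filter_upwards [not_frequently.1 hx, eventually_ge_atTop N] with d hd hNd
    by_contra hcon
    exact hd ⟨hNd, hcon⟩
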